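/- For a smooth manifold $M$ and an integer $k\ge 0$, let $\Omega^k(M)$ be the space of smooth real-valued differential $k$-forms on $M$ (with $\Omega^{-1}(M)=0$), let $Z^k(M)=\{\omega\in\Omega^k(M) : d\omega=0\}$ be the space of closed forms and $B^k(M)=d\,\Omega^{k-1}(M)$ the space of exact forms. Let $$\overline{Z}^k(M)=\{\lambda\in Z^k(M) : \text{there are a compact set } K\subseteq M \text{ and } \nu\in\Omega^{k-1}(M\setminus K) \text{ with } d\nu=\lambda|_{M\setminus K}\}$$ be the space of closed $k$-forms that are exact outside a compact set. Then $B^k(M)\subseteq\overline{Z}^k(M)$, and one sets $$c_k(M)=\dim_{\mathbb R}\,\overline{Z}^k(M)/B^k(M).$$ Let $U\subseteq S^2$ be an open subset of the $2$-sphere. Then $c_1(U)=0$. -/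

import Mathlib

open scoped Manifold ContDiff Topology

noncomputable section

namespace OpenGenus

variable (E : Type*) [NormedAddCommGroup E] [NormedSpace ℝ E]
variable (M : Type*) [TopologicalSpace M] [ChartedSpace E M]

/-- A (not necessarily smooth) real-valued differential `k`-form on the manifold `M` modelled
on `E`: an alternating `k`-linear form on each tangent space. -/
def RoughForm (k : ℕ) : Type _ :=
  (x : M) → (TangentSpace 𝓘(ℝ, E) x) [⋀^Fin k]→L[ℝ] ℝ

instance (k : ℕ) : AddCommGroup (RoughForm E M k) :=
  inferInstanceAs (AddCommGroup ((x : M) → (TangentSpace 𝓘(ℝ, E) x) [⋀^Fin k]→L[ℝ] ℝ))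

instance (k : ℕ) : Module ℝ (RoughForm E M k) :=
  inferInstanceAs (Module ℝ ((x : M) → (TangentSpace 𝓘(ℝ, E) x) [⋀^Fin k]→L[ℝ] ℝ))

variable {E M}

@[simp] lemma RoughForm.zero_apply {k : ℕ} (x : M) : (0 : RoughForm E M k) x = 0 := rfl

@[simp] lemma RoughForm.add_apply {k : ℕ} (α β : RoughForm E M k) (x : M) :
    (α + β) x = α x + β x := rfl

@[simp] lemma RoughForm.smul_apply {k : ℕ} (c : ℝ) (α : RoughForm E M k) (x : M) :
    (c • α) x = c • α x := rfl

/-- The expression of a form `α` in a chart `e`, that is, the pullback `(e⁻¹)^* α`, a form on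
`e.target` (with irrelevant values outside `e.target`). -/
def localRep {k : ℕ} (e : OpenPartialHomeomorph M E) (α : RoughForm E M k) :
    E → E [⋀^Fin k]→L[ℝ] ℝ :=
  fun y => (α (e.symm y)).compContinuousLinearMap (mfderiv 𝓘(ℝ, E) 𝓘(ℝ, E) e.symm y)

/-- `α` is smooth on the open set `W`: it is smooth in every chart of the atlas. -/
def IsSmoothOn {k : ℕ} (α : RoughForm E M k) (W : Set M) : Prop :=
  ∀ e ∈ atlas E M, ContDiffOn ℝ ∞ (localRep e α) (e.target ∩ e.symm ⁻¹' W)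

/-- The exterior derivative, computed at `x` in the preferred chart at `x`: it is
`e^* (d ((e⁻¹)^* α))`. -/
def dForm {k : ℕ} (α : RoughForm E M k) : RoughForm E M (k + 1) :=
  fun x => (extDeriv (localRep (chartAt E x) α) (chartAt E x x)).compContinuousLinearMap
    (mfderiv 𝓘(ℝ, E) 𝓘(ℝ, E) (chartAt E x) x)

/-- `α` is exact on the open set `W`: there is a smooth `(k-1)`-form `ν` on `W` with `dν = α|_W`.
(The values of `ν` outside `W` are irrelevant. In degree `0` the only exact form is zero.) -/
def IsExactOn : {k : ℕ} → RoughForm E M k → Set M → Prop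
  | 0, α, W => ∀ x ∈ W, α x = 0
  | _ + 1, α, W => ∃ ν : RoughForm E M _, IsSmoothOn ν W ∧ ∀ x ∈ W, dForm ν x = α x

section linear

variable {k : ℕ}

lemma localRep_add (e : OpenPartialHomeomorph M E) (α β : RoughForm E M k) :
    localRep e (α + β) = localRep e α + localRep e β := rfl

lemma localRep_smul (e : OpenPartialHomeomorph M E) (c : ℝ) (α : RoughForm E M k) :
    localRep e (c • α) = c • localRep e α := rfl

lemma localRep_zero (e : OpenPartialHomeomorph M E) :
    localRep e (0 : RoughForm E M k) = 0 := rfl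

lemma isSmoothOn_zero (W : Set M) : IsSmoothOn (0 : RoughForm E M k) W :=
  fun e _ => by rw [localRep_zero]; exact contDiffOn_const

lemma IsSmoothOn.add {α β : RoughForm E M k} {W : Set M} (hα : IsSmoothOn α W)
    (hβ : IsSmoothOn β W) : IsSmoothOn (α + β) W :=
  fun e he => by rw [localRep_add]; exact (hα e he).add (hβ e he)

lemma IsSmoothOn.smul (c : ℝ) {α : RoughForm E M k} {W : Set M} (hα : IsSmoothOn α W) :
    IsSmoothOn (c • α) W :=
  fun e he => by rw [localRep_smul]; exact (hα e he).const_smul c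

lemma IsSmoothOn.mono {α : RoughForm E M k} {W W' : Set M} (hα : IsSmoothOn α W)
    (h : W' ⊆ W) : IsSmoothOn α W' :=
  fun e he => (hα e he).mono fun _ hy => ⟨hy.1, h hy.2⟩

lemma IsSmoothOn.differentiableAt {α : RoughForm E M k} {W : Set M} (hα : IsSmoothOn α W)
    (hW : IsOpen W) {x : M} (hx : x ∈ W) :
    DifferentiableAt ℝ (localRep (chartAt E x) α) (chartAt E x x) := by
  have hopen : IsOpen ((chartAt E x).target ∩ (chartAt E x).symm ⁻¹' W) :=
    (chartAt E x).isOpen_inter_preimage_symm hW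
  have hmem : chartAt E x x ∈ (chartAt E x).target ∩ (chartAt E x).symm ⁻¹' W :=
    ⟨mem_chart_target E x, by simpa using hx⟩
  exact ((hα _ (chart_mem_atlas E x)).contDiffAt (hopen.mem_nhds hmem)).differentiableAt
    (by simp)

lemma dForm_zero : dForm (0 : RoughForm E M k) = 0 := by
  funext x
  have h : extDeriv (0 : E → E [⋀^Fin k]→L[ℝ] ℝ) (chartAt E x x) = 0 := by
    simpa using extDeriv_smul (x := chartAt E x x) (0 : ℝ) (0 : E → E [⋀^Fin k]→L[ℝ] ℝ)
  rw [dForm, localRep_zero, h]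
  rfl

lemma dForm_add {α β : RoughForm E M k} {W : Set M} (hW : IsOpen W) (hα : IsSmoothOn α W)
    (hβ : IsSmoothOn β W) {x : M} (hx : x ∈ W) :
    dForm (α + β) x = dForm α x + dForm β x := by
  rw [dForm, localRep_add,
    extDeriv_add (hα.differentiableAt hW hx) (hβ.differentiableAt hW hx)]
  rfl

lemma dForm_smul (c : ℝ) (α : RoughForm E M k) : dForm (c • α) = c • dForm α := by
  funext x
  rw [dForm, localRep_smul, extDeriv_smul]
  rfl

lemma isExactOn_zero (W : Set M) : IsExactOn (0 : RoughForm E M k) W := by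
  cases k with
  | zero => exact fun _ _ => rfl
  | succ k => exact ⟨0, isSmoothOn_zero W, fun x _ => by rw [dForm_zero]⟩

lemma IsExactOn.add {α β : RoughForm E M k} {W : Set M} (hW : IsOpen W)
    (hα : IsExactOn α W) (hβ : IsExactOn β W) : IsExactOn (α + β) W := by
  cases k with
  | zero => exact fun x hx => by rw [RoughForm.add_apply, hα x hx, hβ x hx, add_zero]
  | succ k =>
    obtain ⟨ν, hν, h⟩ := hα
    obtain ⟨ν', hν', h'⟩ := hβ
    exact ⟨ν + ν', hν.add hν', fun x hx => by
      rw [dForm_add hW hν hν' hx, h x hx, h' x hx, RoughForm.add_apply]⟩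

lemma IsExactOn.smul (c : ℝ) {α : RoughForm E M k} {W : Set M} (hα : IsExactOn α W) :
    IsExactOn (c • α) W := by
  cases k with
  | zero => exact fun x hx => by rw [RoughForm.smul_apply, hα x hx, smul_zero]
  | succ k =>
    obtain ⟨ν, hν, h⟩ := hα
    exact ⟨c • ν, hν.smul c, fun x hx => by
      rw [dForm_smul, RoughForm.smul_apply, RoughForm.smul_apply, h x hx]⟩

lemma IsExactOn.mono {α : RoughForm E M k} {W W' : Set M} (hα : IsExactOn α W)
    (h : W' ⊆ W) : IsExactOn α W' := by
  cases k with
  | zero => exact fun x hx => hα x (h hx)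
  | succ k =>
    obtain ⟨ν, hν, h'⟩ := hα
    exact ⟨ν, hν.mono h, fun x hx => h' x (h hx)⟩

end linear

variable (E M)

/-- `Z^k(M)`: the smooth closed `k`-forms. -/
def closedForms (k : ℕ) : Submodule ℝ (RoughForm E M k) where
  carrier := {α | IsSmoothOn α Set.univ ∧ dForm α = 0}
  zero_mem' := ⟨isSmoothOn_zero _, dForm_zero⟩
  add_mem' {α β} hα hβ := ⟨hα.1.add hβ.1, by
    funext x
    rw [dForm_add isOpen_univ hα.1 hβ.1 (Set.mem_univ x), hα.2, hβ.2]
    exact add_zero _⟩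
  smul_mem' c α hα := ⟨hα.1.smul c, by rw [dForm_smul, hα.2, smul_zero]⟩

/-- `B^k(M)`: the exact `k`-forms, `{dν | ν ∈ Ω^{k-1}(M)}`. -/
def exactForms (k : ℕ) : Submodule ℝ (RoughForm E M k) where
  carrier := {α | IsExactOn α Set.univ}
  zero_mem' := isExactOn_zero _
  add_mem' hα hβ := hα.add isOpen_univ hβ
  smul_mem' c _ hα := hα.smul c

/-- The smooth closed `k`-forms that are exact outside a compact set. -/
def closedFormsExactAtInfinity [T2Space M] (k : ℕ) : Submodule ℝ (RoughForm E M k) where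
  carrier := {α | α ∈ closedForms E M k ∧ ∃ K : Set M, IsCompact K ∧ IsExactOn α Kᶜ}
  zero_mem' := ⟨Submodule.zero_mem _, ∅, isCompact_empty, isExactOn_zero _⟩
  add_mem' := by
    rintro α β ⟨hα, K, hK, h⟩ ⟨hβ, L, hL, h'⟩
    refine ⟨Submodule.add_mem _ hα hβ, K ∪ L, hK.union hL, ?_⟩
    exact (h.mono (Set.compl_subset_compl.2 Set.subset_union_left)).add
      (hK.union hL).isClosed.isOpen_compl
      (h'.mono (Set.compl_subset_compl.2 Set.subset_union_right))
  smul_mem' := by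
    rintro c α ⟨hα, K, hK, h⟩
    exact ⟨Submodule.smul_mem _ c hα, K, hK, h.smul c⟩

/-- The quotient of the closed `k`-forms that are exact outside a compact set by the subspace of
exact `k`-forms. -/
abbrev HBar [T2Space M] (k : ℕ) : Type _ :=
  (closedFormsExactAtInfinity E M k) ⧸
    (exactForms E M k).submoduleOf (closedFormsExactAtInfinity E M k)

/-- `c_k(M)`, the real dimension (a cardinal) of this quotient, for a smooth Hausdorff manifold
`M` modelled on `E`. -/
def c [T2Space M] (k : ℕ) : Cardinal := Module.rank ℝ (HBar E M k)

end OpenGenus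

end

/-! Let `α` be closed on `U` with `α = df` off a compact `K ⊆ U`. Take a smooth `χ` on the sphere
that is 0 near `K` and 1 near the complement of `U`. Then `g = χ f` is smooth on `U`, and `α - dg`
vanishes near the frontier of `U`, so its extension by zero is closed on the sphere. Since `H¹(S²) =
0`, the extension is `dF`, whence `α = d(F + g)` on `U` (`isExactOn_univ_of_isExactOn_compl`).

The vanishing of `H¹` (`exists_isPrimitiveAt_sphere`) comes from two stereographic charts: the
Poincaré lemma gives a primitive on each, and they differ by a constant on the connected overlap.

Closedness on the sphere is replaced by local exactness: every point has a neighbourhood with a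
primitive. This passes easily through charts, open inclusions and extension by zero. -/

open scoped Manifold ContDiff Topology

noncomputable section

namespace OpenGenus

open ContinuousAlternatingMap

/-! ### Pointwise primitives and the Poincaré lemma on convex sets -/

section Primitive

variable {E : Type*} [NormedAddCommGroup E] [NormedSpace ℝ E]
variable {M : Type*} [TopologicalSpace M] [ChartedSpace E M]

/-- A smooth closed `1`-form on an open convex set has a smooth primitive. -/
lemma exists_contDiffOn_hasFDerivAt_of_symmetric {θ : E → E →L[ℝ] ℝ} {s : Set E}
    (hs : Convex ℝ s) (hso : IsOpen s) (hθ : ContDiffOn ℝ ∞ θ s)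
    (hsymm : ∀ a ∈ s, ∀ u v, fderiv ℝ θ a u v = fderiv ℝ θ a v u) :
    ∃ f : E → ℝ, ∀ a ∈ s, ContDiffAt ℝ ∞ f a ∧ HasFDerivAt f (θ a) a := by
  obtain ⟨f, hf⟩ := hs.exists_forall_hasFDerivAt_of_fderiv_symmetric hso
    (hθ.differentiableOn (by simp)) hsymm
  have hsm : ContDiffOn ℝ ∞ f s := by
    -- The derivative of `f` is the smooth field `θ`, so `f` is itself smooth.
    rw [contDiffOn_infty_iff_fderiv_of_isOpen hso]
    exact ⟨fun a ha => (hf a ha).differentiableAt.differentiableWithinAt,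
      hθ.congr fun a ha => (hf a ha).fderiv⟩
  exact ⟨f, fun a ha => ⟨hsm.contDiffAt (hso.mem_nhds ha), hf a ha⟩⟩

/-- The function `f` is smooth at `x` and its differential there is `θ x`. -/
def IsPrimitiveAt (f : M → ℝ) (θ : M → E →L[ℝ] ℝ) (x : M) : Prop :=
  ContMDiffAt 𝓘(ℝ, E) 𝓘(ℝ, ℝ) ∞ f x ∧ HasMFDerivAt 𝓘(ℝ, E) 𝓘(ℝ, ℝ) f x (θ x)

lemma IsPrimitiveAt.congr {f g : M → ℝ} {θ : M → E →L[ℝ] ℝ} {x : M}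
    (h : IsPrimitiveAt f θ x) (hfg : g =ᶠ[𝓝 x] f) : IsPrimitiveAt g θ x :=
  ⟨h.1.congr_of_eventuallyEq hfg, h.2.congr_of_eventuallyEq hfg⟩

/-- Only the value of the covector field at `x` matters, so no smoothness of the field ever has to
be checked. -/
lemma IsPrimitiveAt.congr_form {f : M → ℝ} {θ η : M → E →L[ℝ] ℝ} {x : M}
    (h : IsPrimitiveAt f θ x) (hθη : η x = θ x) : IsPrimitiveAt f η x := by
  refine ⟨h.1, ?_⟩
  rw [hθη]
  exact h.2

lemma IsPrimitiveAt.add {f g : M → ℝ} {θ η : M → E →L[ℝ] ℝ} {x : M}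
    (hf : IsPrimitiveAt f θ x) (hg : IsPrimitiveAt g η x) :
    IsPrimitiveAt (f + g) (θ + η) x :=
  ⟨hf.1.add hg.1, hf.2.add hg.2⟩

lemma IsPrimitiveAt.sub {f g : M → ℝ} {θ η : M → E →L[ℝ] ℝ} {x : M}
    (hf : IsPrimitiveAt f θ x) (hg : IsPrimitiveAt g η x) :
    IsPrimitiveAt (f - g) (θ - η) x :=
  ⟨hf.1.sub hg.1, hf.2.sub hg.2⟩

lemma isPrimitiveAt_const (a : ℝ) (x : M) :
    IsPrimitiveAt (fun _ => a) (0 : M → E →L[ℝ] ℝ) x :=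
  ⟨contMDiffAt_const, hasMFDerivAt_const a x⟩

/-- The pullback of `θ` under the inverse of the chart `e`. -/
def chartPullback (e : OpenPartialHomeomorph M E) (θ : M → E →L[ℝ] ℝ) : E → E →L[ℝ] ℝ :=
  fun y => (θ (e.symm y)).comp
    (show E →L[ℝ] E from mfderiv 𝓘(ℝ, E) 𝓘(ℝ, E) e.symm y)

variable [IsManifold 𝓘(ℝ, E) ∞ M] {e : OpenPartialHomeomorph M E}

lemma mdifferentiable_of_mem_atlas_infty (he : e ∈ atlas E M) :
    e.MDifferentiable 𝓘(ℝ, E) 𝓘(ℝ, E) :=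
  haveI : IsManifold 𝓘(ℝ, E) 1 M := IsManifold.of_le (n := ∞) (by simp)
  mdifferentiable_of_mem_atlas he

lemma IsPrimitiveAt.comp_chart_symm {f : M → ℝ} {θ : M → E →L[ℝ] ℝ} (he : e ∈ atlas E M)
    {y : E} (hy : y ∈ e.target) (h : IsPrimitiveAt f θ (e.symm y)) :
    ContDiffAt ℝ ∞ (f ∘ e.symm) y ∧ HasFDerivAt (f ∘ e.symm) (chartPullback e θ y) y := by
  constructor
  · rw [← contMDiffAt_iff_contDiffAt]
    exact h.1.comp y (contMDiffAt_symm_of_mem_maximalAtlas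
      (IsManifold.subset_maximalAtlas he) hy)
  · exact hasMFDerivAt_iff_hasFDerivAt.1 (h.2.comp y
      ((mdifferentiable_of_mem_atlas_infty he).mdifferentiableAt_symm hy).hasMFDerivAt)

lemma isPrimitiveAt_comp_chart {f : E → ℝ} {θ : M → E →L[ℝ] ℝ} (he : e ∈ atlas E M)
    {x : M} (hx : x ∈ e.source) (hf : ContDiffAt ℝ ∞ f (e x))
    (h : HasFDerivAt f (chartPullback e θ (e x)) (e x)) : IsPrimitiveAt (f ∘ e) θ x := by
  refine ⟨hf.contMDiffAt.comp x (contMDiffAt_of_mem_maximalAtlas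
    (IsManifold.subset_maximalAtlas he) hx), ?_⟩
  have hd := mdifferentiable_of_mem_atlas_infty he
  have h1 := h.hasMFDerivAt.comp x (hd.mdifferentiableAt hx).hasMFDerivAt
  have hθ : θ x = (chartPullback e θ (e x)).comp
      (show E →L[ℝ] E from mfderiv 𝓘(ℝ, E) 𝓘(ℝ, E) e x) := by
    ext v
    -- The points `e.symm (e x)` and `x` index different tangent spaces; generalising both point and
    -- vector permits substitution.
    have key : ∀ x' : M, x' = x → ∀ w : E, w = v → θ x v = θ x' w := by
      rintro _ rfl _ rfl; rfl
    exact key _ (e.left_inv hx) _ (DFunLike.congr_fun (hd.symm_comp_deriv hx) v)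
  rw [hθ]
  exact h1

end Primitive

/-! ### Forms of degree 0 and 1 as functions and covector fields -/

section Forms

variable {E : Type*} [NormedAddCommGroup E] [NormedSpace ℝ E]
variable {M : Type*} [TopologicalSpace M] [ChartedSpace E M]

/-- Alternating `1`-linear forms are linear functionals. -/
def oneFormEquiv (E : Type*) [NormedAddCommGroup E] [NormedSpace ℝ E] :
    (E [⋀^Fin 1]→L[ℝ] ℝ) ≃ₗᵢ[ℝ] (E →L[ℝ] ℝ) :=
  (ofSubsingletonLIE (0 : Fin 1)).symm

/-- A `1`-form as a field of linear functionals. -/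
def RoughForm.toCovector (α : RoughForm E M 1) : M → E →L[ℝ] ℝ :=
  fun x => oneFormEquiv E (α x)

lemma chartPullback_toCovector (e : OpenPartialHomeomorph M E) (α : RoughForm E M 1) :
    chartPullback e α.toCovector = oneFormEquiv E ∘ localRep e α := rfl

/-- The function attached to a `0`-form. -/
def RoughForm.toFunction (ν : RoughForm E M 0) : M → ℝ := fun x => ν x 0

/-- The `0`-form attached to a function. -/
def RoughForm.ofFunction (f : M → ℝ) : RoughForm E M 0 :=
  fun x => constOfIsEmpty ℝ E (Fin 0) (f x)

lemma RoughForm.ofFunction_toFunction (ν : RoughForm E M 0) :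
    RoughForm.ofFunction ν.toFunction = ν := by
  funext x
  ext v
  exact congrArg (ν x) (Subsingleton.elim _ _)

variable [IsManifold 𝓘(ℝ, E) ∞ M] {e : OpenPartialHomeomorph M E}

/-- Change of charts for the local expression of a form. -/
lemma localRep_eq_pullback {k : ℕ} (α : RoughForm E M k) {c : OpenPartialHomeomorph M E}
    (he : e ∈ atlas E M) (hc : c ∈ atlas E M) {y : E} (hy : y ∈ e.target)
    (hyc : e.symm y ∈ c.source) :
    localRep e α y = (localRep c α ((c ∘ e.symm) y)).compContinuousLinearMap
      (fderiv ℝ (c ∘ e.symm) y) := by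
  have hde := mdifferentiable_of_mem_atlas_infty he
  have hdc := mdifferentiable_of_mem_atlas_infty hc
  have h1 : HasMFDerivAt 𝓘(ℝ, E) 𝓘(ℝ, E) (c ∘ e.symm) y
      (fderiv ℝ (c ∘ e.symm) y) := by
    have := ((hdc.mdifferentiableAt hyc).comp y (hde.mdifferentiableAt_symm hy))
    exact (mdifferentiableAt_iff_differentiableAt.1 this).hasFDerivAt.hasMFDerivAt
  have h2 := (hdc.mdifferentiableAt_symm (c.map_source hyc)).hasMFDerivAt.comp y h1
  have h3 : e.symm =ᶠ[𝓝 y] c.symm ∘ (c ∘ e.symm) := by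
    filter_upwards [(e.isOpen_inter_preimage_symm c.open_source).mem_nhds ⟨hy, hyc⟩] with z hz
    exact (c.left_inv hz.2).symm
  have h4 := (h2.congr_of_eventuallyEq h3).mfderiv
  have key : ∀ x' : M, x' = e.symm y → ∀ v w : Fin k → E, v = w →
      (show ContinuousAlternatingMap ℝ E ℝ (Fin k) from α (e.symm y)) v
        = (show ContinuousAlternatingMap ℝ E ℝ (Fin k) from α x') w := by
    rintro _ rfl _ _ rfl; rfl
  ext v
  exact key _ (c.left_inv hyc) _ _ (funext fun i => DFunLike.congr_fun h4 (v i))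

/-- A closed form is closed in every chart. -/
lemma extDeriv_localRep_eq_zero {k : ℕ} {α : RoughForm E M k} (hα : α ∈ closedForms E M k)
    (he : e ∈ atlas E M) {y : E} (hy : y ∈ e.target) : extDeriv (localRep e α) y = 0 := by
  set x := e.symm y
  set c := chartAt E x
  have hc : c ∈ atlas E M := chart_mem_atlas E x
  have hxc : x ∈ c.source := mem_chart_source E x
  have hdc := mdifferentiable_of_mem_atlas_infty hc
  have h1 : localRep e α =ᶠ[𝓝 y] fun z =>
      (localRep c α ((c ∘ e.symm) z)).compContinuousLinearMap (fderiv ℝ (c ∘ e.symm) z) := by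
    filter_upwards [(e.isOpen_inter_preimage_symm c.open_source).mem_nhds ⟨hy, hxc⟩] with z hz
    exact localRep_eq_pullback α he hc hz.1 hz.2
  have hsm : ContDiffAt ℝ ∞ (c ∘ e.symm) y := by
    rw [← contMDiffAt_iff_contDiffAt]
    exact (contMDiffAt_of_mem_maximalAtlas (IsManifold.subset_maximalAtlas hc) hxc).comp y
      (contMDiffAt_symm_of_mem_maximalAtlas (IsManifold.subset_maximalAtlas he) hy)
  have h2 : extDeriv (localRep c α) (c x) = 0 := by
    have h3 : dForm α x = 0 := by rw [hα.2]; rfl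
    ext v
    -- `dForm` is a pullback by the chart's derivative; surjectivity of that derivative lets it be
    -- cancelled.
    choose w hw using fun i => hdc.mfderiv_surjective hxc (v i)
    have h4 : dForm α x w = 0 := by rw [h3]; rfl
    have h5 : v = fun i => mfderiv 𝓘(ℝ, E) 𝓘(ℝ, E) c x (w i) := (funext hw).symm
    rw [h5]
    exact h4
  have hd : DifferentiableAt ℝ (localRep c α) ((c ∘ e.symm) y) :=
    hα.1.differentiableAt isOpen_univ (Set.mem_univ x)
  rw [h1.extDeriv_eq, extDeriv_pullback hd hsm
    (by rw [minSmoothness_of_isRCLikeNormedField]; exact ENat.LEInfty.out)]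
  show (extDeriv (localRep c α) (c x)).compContinuousLinearMap _ = 0
  rw [h2]
  rfl

/-- A closed `1`-form has a primitive near every point. -/
lemma exists_eventually_isPrimitiveAt {α : RoughForm E M 1} (hα : α ∈ closedForms E M 1) (x : M) :
    ∃ f : M → ℝ, ∀ᶠ z in 𝓝 x, IsPrimitiveAt f α.toCovector z := by
  set c := chartAt E x
  have hc : c ∈ atlas E M := chart_mem_atlas E x
  have hxc : x ∈ c.source := mem_chart_source E x
  obtain ⟨r, hr, hball⟩ := Metric.isOpen_iff.1 c.open_target (c x) (c.map_source hxc)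
  have hsm : ContDiffOn ℝ ∞ (localRep c α) (Metric.ball (c x) r) :=
    (hα.1 c hc).mono fun y hy => ⟨hball hy, trivial⟩
  have hfun := chartPullback_toCovector c α
  obtain ⟨f, hf⟩ := exists_contDiffOn_hasFDerivAt_of_symmetric (convex_ball (c x) r)
    Metric.isOpen_ball (θ := chartPullback c α.toCovector)
    (by
      rw [hfun]
      exact (LinearIsometryEquiv.contDiff _).comp_contDiffOn hsm)
    (by
      intro a ha u v
      have hd : DifferentiableAt ℝ (localRep c α) a :=
        (hsm.contDiffAt (Metric.isOpen_ball.mem_nhds ha)).differentiableAt (by simp)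
      have h0 := extDeriv_localRep_eq_zero hα hc (hball ha)
      have h1 : extDeriv (localRep c α) a ![u, v] = 0 := by rw [h0]; rfl
      -- On `(u, v)` the exterior derivative is `Dα(u)(v) - Dα(v)(u)`, so closedness is symmetry of
      -- the derivative.
      rw [extDeriv, alternatizeUncurryFin_apply, Fin.sum_univ_two] at h1
      have hu : (0 : Fin 2).removeNth ![u, v] = fun _ => v := by
        ext i; fin_cases i; rfl
      have hv : (1 : Fin 2).removeNth ![u, v] = fun _ => u := by
        ext i; fin_cases i; rfl
      rw [hu, hv] at h1
      rw [hfun, LinearIsometryEquiv.comp_fderiv]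
      simp only [Fin.val_zero, pow_zero, Fin.val_one, pow_one, one_smul, neg_smul,
        Matrix.cons_val_zero, Matrix.cons_val_one] at h1
      exact sub_eq_zero.1 ((sub_eq_add_neg _ _).trans h1))
  refine ⟨f ∘ c, ?_⟩
  filter_upwards [(c.isOpen_inter_preimage Metric.isOpen_ball).mem_nhds
    ⟨hxc, Metric.mem_ball_self hr⟩] with z hz
  exact isPrimitiveAt_comp_chart hc hz.1 (hf _ hz.2).1 (hf _ hz.2).2

lemma isSmoothOn_ofFunction_iff {f : M → ℝ} {W : Set M} (hW : IsOpen W) :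
    IsSmoothOn (RoughForm.ofFunction (E := E) f) W ↔
      ∀ x ∈ W, ContMDiffAt 𝓘(ℝ, E) 𝓘(ℝ, ℝ) ∞ f x := by
  have hrep : ∀ e : OpenPartialHomeomorph M E, localRep e (RoughForm.ofFunction f) =
      constOfIsEmptyLIE ℝ E ℝ (Fin 0) ∘ (f ∘ e.symm) := fun e => rfl
  constructor
  · intro h x hx
    set c := chartAt E x
    have hc : c ∈ atlas E M := chart_mem_atlas E x
    have hxc : x ∈ c.source := mem_chart_source E x
    have h1 := h c hc
    rw [hrep] at h1
    replace h1 := (constOfIsEmptyLIE ℝ E ℝ (Fin 0)).toContinuousLinearEquiv.comp_contDiffOn_iff.1 h1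
    have h2 : ContDiffAt ℝ ∞ (f ∘ c.symm) (c x) := h1.contDiffAt
      ((c.isOpen_inter_preimage_symm hW).mem_nhds
        ⟨c.map_source hxc, by simpa [c.left_inv hxc] using hx⟩)
    have h3 := h2.contMDiffAt.comp x (contMDiffAt_of_mem_maximalAtlas
      (I := 𝓘(ℝ, E)) (IsManifold.subset_maximalAtlas hc) hxc)
    refine h3.congr_of_eventuallyEq ?_
    filter_upwards [c.open_source.mem_nhds hxc] with z hz
    simp [c.left_inv hz]
  · intro h e he y hy
    rw [hrep]
    refine ContDiffAt.contDiffWithinAt ?_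
    refine (LinearIsometryEquiv.contDiff _).contDiffAt.comp y ?_
    rw [← contMDiffAt_iff_contDiffAt]
    exact (h _ hy.2).comp y
      (contMDiffAt_symm_of_mem_maximalAtlas (IsManifold.subset_maximalAtlas he) hy.1)

lemma dForm_ofFunction {f : M → ℝ} {θ : M → E →L[ℝ] ℝ} {x : M} (h : IsPrimitiveAt f θ x) :
    (dForm (RoughForm.ofFunction (E := E) f)).toCovector x = θ x := by
  set c := chartAt E x
  have hc : c ∈ atlas E M := chart_mem_atlas E x
  have hxc : x ∈ c.source := mem_chart_source E x
  have hd := mdifferentiable_of_mem_atlas_infty hc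
  have h1 : HasFDerivAt (f ∘ c.symm) (chartPullback c θ (c x)) (c x) :=
    (IsPrimitiveAt.comp_chart_symm hc (c.map_source hxc)
      (by rw [c.left_inv hxc]; exact h)).2
  have h2 := extDeriv_constOfIsEmpty (𝕜 := ℝ) (f ∘ c.symm) (c x)
  rw [h1.fderiv] at h2
  ext v
  have h3 : (dForm (RoughForm.ofFunction (E := E) f)).toCovector x v
      = chartPullback c θ (c x) (mfderiv 𝓘(ℝ, E) 𝓘(ℝ, E) c x v) :=
    DFunLike.congr_fun h2 (fun _ => mfderiv 𝓘(ℝ, E) 𝓘(ℝ, E) c x v)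
  rw [h3]
  have key : ∀ x' : M, x' = x → ∀ w : E, w = v → θ x' w = θ x v := by
    rintro _ rfl _ rfl; rfl
  exact key _ (c.left_inv hxc) _ (DFunLike.congr_fun (hd.symm_comp_deriv hxc) v)

/-- A `1`-form is exact on an open set exactly when it has a primitive there. -/
lemma isExactOn_iff_exists_isPrimitiveAt {α : RoughForm E M 1} {W : Set M} (hW : IsOpen W) :
    IsExactOn α W ↔ ∃ f : M → ℝ, ∀ x ∈ W, IsPrimitiveAt f α.toCovector x := by
  constructor
  · rintro ⟨ν, hν, hd⟩
    rw [← ν.ofFunction_toFunction] at hν hd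
    rw [isSmoothOn_ofFunction_iff hW] at hν
    refine ⟨ν.toFunction, fun x hx => ⟨hν x hx, ?_⟩⟩
    have h1 := ((hν x hx).mdifferentiableAt (by simp)).hasMFDerivAt
    have h2 := dForm_ofFunction (E := E)
      (θ := fun x => mfderiv 𝓘(ℝ, E) 𝓘(ℝ, ℝ) ν.toFunction x) ⟨hν x hx, h1⟩
    have h3 : α.toCovector x = mfderiv 𝓘(ℝ, E) 𝓘(ℝ, ℝ) ν.toFunction x := by
      rw [← h2]
      exact congrArg (oneFormEquiv E) (hd x hx).symm
    rw [h3]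
    exact h1
  · rintro ⟨f, hf⟩
    refine ⟨RoughForm.ofFunction f, (isSmoothOn_ofFunction_iff hW).2 fun x hx => (hf x hx).1,
      fun x hx => ?_⟩
    exact (oneFormEquiv E).injective (dForm_ofFunction (hf x hx))

end Forms

/-! ### From local exactness to exactness on a chart -/

section Glue

variable {E : Type*} [NormedAddCommGroup E] [NormedSpace ℝ E]
variable {M : Type*} [TopologicalSpace M] [ChartedSpace E M] [IsManifold 𝓘(ℝ, E) ∞ M]
variable {e : OpenPartialHomeomorph M E}

/-- A locally exact `1`-form is exact on the domain of a chart with convex image. -/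
lemma exists_isPrimitiveAt_chart_source {θ : M → E →L[ℝ] ℝ} (he : e ∈ atlas E M)
    (hconv : Convex ℝ e.target)
    (hθ : ∀ x ∈ e.source, ∃ f : M → ℝ, ∀ᶠ z in 𝓝 x, IsPrimitiveAt f θ z) :
    ∃ f : M → ℝ, ∀ x ∈ e.source, IsPrimitiveAt f θ x := by
  have hloc : ∀ y ∈ e.target, ContDiffAt ℝ ∞ (chartPullback e θ) y ∧
      ∀ u v, fderiv ℝ (chartPullback e θ) y u v = fderiv ℝ (chartPullback e θ) y v u := by
    intro y hy
    obtain ⟨f, hf⟩ := hθ (e.symm y) (e.map_target hy)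
    have h1 : ∀ᶠ z in 𝓝 y, ContDiffAt ℝ ∞ (f ∘ e.symm) z ∧
        HasFDerivAt (f ∘ e.symm) (chartPullback e θ z) z := by
      filter_upwards [(e.continuousAt_symm hy).eventually hf, e.open_target.mem_nhds hy]
        with z hz hzt
      exact hz.comp_chart_symm he hzt
    -- Locally the pullback is the derivative of a smooth function: hence it is smooth, and its
    -- derivative is symmetric by Schwarz.
    have h2 : chartPullback e θ =ᶠ[𝓝 y] fderiv ℝ (f ∘ e.symm) :=
      h1.mono fun z hz => hz.2.fderiv.symm
    have hsm := h1.self_of_nhds.1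
    refine ⟨(hsm.fderiv_right (m := ∞) le_rfl).congr_of_eventuallyEq h2, fun u v => ?_⟩
    rw [h2.fderiv_eq]
    exact (hsm.isSymmSndFDerivAt
      (by rw [minSmoothness_of_isRCLikeNormedField]; exact ENat.LEInfty.out)) u v
  obtain ⟨f, hf⟩ := exists_contDiffOn_hasFDerivAt_of_symmetric hconv e.open_target
    (fun y hy => (hloc y hy).1.contDiffWithinAt) (fun y hy => (hloc y hy).2)
  exact ⟨f ∘ e, fun x hx => isPrimitiveAt_comp_chart he hx (hf _ (e.map_source hx)).1
    (hf _ (e.map_source hx)).2⟩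

end Glue

/-! ### Vanishing of first cohomology of the sphere -/

section Sphere

variable {F : Type*} [NormedAddCommGroup F] [InnerProductSpace ℝ F] {n : ℕ}
  [Fact (Module.finrank ℝ F = n + 1)]

lemma stereographic'_mem_atlas (v : Metric.sphere (0 : F) 1) :
    stereographic' n v ∈ atlas (EuclideanSpace ℝ (Fin n)) (Metric.sphere (0 : F) 1) :=
  ⟨v, rfl⟩

/-- A locally exact `1`-form on a sphere of dimension at least `2` is exact. -/
lemma exists_isPrimitiveAt_sphere (hn : 2 ≤ n)
    {θ : Metric.sphere (0 : F) 1 → EuclideanSpace ℝ (Fin n) →L[ℝ] ℝ}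
    (hθ : ∀ x, ∃ f : Metric.sphere (0 : F) 1 → ℝ, ∀ᶠ z in 𝓝 x, IsPrimitiveAt f θ z) :
    ∃ f : Metric.sphere (0 : F) 1 → ℝ, ∀ x, IsPrimitiveAt f θ x := by
  classical
  have hsph : (Metric.sphere (0 : F) 1).Nonempty := by
    have : Nontrivial F := Module.nontrivial_of_finrank_pos (R := ℝ)
      (by rw [(Fact.out : Module.finrank ℝ F = n + 1)]; omega)
    exact NormedSpace.sphere_nonempty.2 zero_le_one
  let v : Metric.sphere (0 : F) 1 := ⟨_, hsph.some_mem⟩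
  have hv : -v ≠ v := fun h => ne_neg_of_mem_unit_sphere ℝ v h.symm
  have hprim : ∀ w : Metric.sphere (0 : F) 1, ∃ f : Metric.sphere (0 : F) 1 → ℝ,
      ∀ x, x ≠ w → IsPrimitiveAt f θ x := fun w => by
    obtain ⟨f, hf⟩ := exists_isPrimitiveAt_chart_source (stereographic'_mem_atlas (n := n) w)
      (by rw [stereographic'_target]; exact convex_univ) fun x _ => hθ x
    exact ⟨f, fun x hx => hf x (by rw [stereographic'_source]; exact hx)⟩
  obtain ⟨f₁, hf₁⟩ := hprim v
  obtain ⟨f₂, hf₂⟩ := hprim (-v)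
  set e := stereographic' n v
  have he : e ∈ atlas (EuclideanSpace ℝ (Fin n)) (Metric.sphere (0 : F) 1) :=
    stereographic'_mem_atlas v
  have htarget : ∀ y, y ∈ e.target := fun y => by rw [stereographic'_target]; trivial
  have hsource : ∀ x, x ≠ v → x ∈ e.source := fun x hx => by
    rw [stereographic'_source]; exact hx
  have hne : ∀ y, e.symm y ≠ v := fun y h => by
    have := e.map_target (htarget y)
    rw [stereographic'_source] at this
    exact this h
  have hconst : ∃ a, ∀ y ∈ ({e (-v)}ᶜ : Set (EuclideanSpace ℝ (Fin n))),
      ((f₁ - f₂) ∘ e.symm) y = a := by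
    have hder : ∀ y ∈ ({e (-v)}ᶜ : Set (EuclideanSpace ℝ (Fin n))),
        HasFDerivAt ((f₁ - f₂) ∘ e.symm)
          (0 : EuclideanSpace ℝ (Fin n) →L[ℝ] ℝ) y := fun y hy => by
      have hy' : e.symm y ≠ -v := fun h => hy (by
        rw [Set.mem_singleton_iff, ← h, e.right_inv (htarget y)])
      have h1 := (((hf₁ _ (hne y)).sub (hf₂ _ hy')).congr_form
        (η := 0) (by simp)).comp_chart_symm he (htarget y)
      have h2 : chartPullback e (0 : Metric.sphere (0 : F) 1 → EuclideanSpace ℝ (Fin n) →L[ℝ] ℝ) y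
          = 0 :=
        ContinuousLinearMap.zero_comp _
      rw [h2] at h1
      exact h1.2
    -- Seen from `v`, the overlap is Euclidean space minus a point, connected because `n ≥ 2`.
    refine isOpen_compl_singleton.exists_is_const_of_fderiv_eq_zero (𝕜 := ℝ)
      (isConnected_compl_singleton_of_one_lt_rank ?_ _).isPreconnected
      (fun y hy => (hder y hy).differentiableAt.differentiableWithinAt)
      (fun y hy => (hder y hy).fderiv)
    rw [← Module.finrank_eq_rank, finrank_euclideanSpace_fin]
    exact_mod_cast hn
  obtain ⟨a, ha⟩ := hconst
  have hdiff : ∀ x, x ≠ v → x ≠ -v → f₁ x = f₂ x + a := fun x hx hx' => by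
    have h1 := ha (e x) fun h => hx' (e.injOn (hsource x hx) (hsource _ hv) h)
    simp only [Function.comp_apply, e.left_inv (hsource x hx), Pi.sub_apply] at h1
    linarith
  -- `f₁` may be wrong only at `v`; with the value there corrected, the function is `f₂ + a` near
  -- `v`.
  refine ⟨fun x => if x = v then f₂ x + a else f₁ x, fun x => ?_⟩
  by_cases hx : x = v
  · have hxv : x ≠ -v := by rw [hx]; exact hv.symm
    have h1 := ((hf₂ x hxv).add (isPrimitiveAt_const a x)).congr_form (η := θ) (by simp)
    refine h1.congr ?_
    filter_upwards [isOpen_compl_singleton.mem_nhds hxv] with z hz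
    by_cases hzv : z = v
    · simp [hzv]
    · simp [hzv, hdiff z hzv hz]
  · refine (hf₁ x hx).congr ?_
    filter_upwards [isOpen_compl_singleton.mem_nhds hx] with z hz
    exact if_neg hz

end Sphere

/-! ### Restriction to open subsets and extension by zero -/

section Opens

variable {E : Type*} [NormedAddCommGroup E] [NormedSpace ℝ E]
variable {M : Type*} [TopologicalSpace M] [ChartedSpace E M]
  {U : TopologicalSpace.Opens M}

/-- The preferred chart of `U` at `x` restricts that of `M`, so the inclusion reads as the identity.
-/
lemma hasMFDerivAt_subtype_val (x : U) :
    HasMFDerivAt 𝓘(ℝ, E) 𝓘(ℝ, E) (Subtype.val : U → M) x (ContinuousLinearMap.id ℝ E) := by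
  refine ⟨continuous_subtype_val.continuousAt, ?_⟩
  have h1 := TopologicalSpace.Opens.chartAt_subtype_val_symm_eventuallyEq (H := E) U (x := x)
  have h2 : ∀ᶠ y in 𝓝 (chartAt E x.val x.val), y ∈ (chartAt E x.val).target :=
    (chartAt E x.val).open_target.mem_nhds (mem_chart_target E x.val)
  have h3 : writtenInExtChartAt 𝓘(ℝ, E) 𝓘(ℝ, E) x (Subtype.val : U → M)
      =ᶠ[𝓝 (chartAt E x.val x.val)] id := by
    filter_upwards [h1, h2] with y hy hyt
    have : writtenInExtChartAt 𝓘(ℝ, E) 𝓘(ℝ, E) x (Subtype.val : U → M) y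
        = chartAt E x.val ((Subtype.val ∘ (chartAt E x).symm) y) := rfl
    rw [this, ← hy, (chartAt E x.val).right_inv hyt, id]
  exact ((hasFDerivAt_id _).congr_of_eventuallyEq h3).hasFDerivWithinAt

/-- Primitives on an open subset are the restrictions of primitives on the manifold. -/
lemma isPrimitiveAt_restrict_iff {f : M → ℝ} {θ : M → E →L[ℝ] ℝ} (x : U) :
    IsPrimitiveAt (fun z : U => f z) (fun z : U => θ z) x ↔ IsPrimitiveAt f θ (x : M) := by
  have hrestr : MDifferentiableAt 𝓘(ℝ, E) 𝓘(ℝ, ℝ) f (x : M) →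
      HasMFDerivAt 𝓘(ℝ, E) 𝓘(ℝ, ℝ) (fun z : U => f z) x
        (show E →L[ℝ] ℝ from mfderiv 𝓘(ℝ, E) 𝓘(ℝ, ℝ) f (x : M)) := fun h =>
    h.hasMFDerivAt.comp x (hasMFDerivAt_subtype_val x)
  constructor
  · rintro ⟨h1, h2⟩
    have h3 := contMDiffAt_subtype_iff.1 h1
    have h4 := h3.mdifferentiableAt (by simp)
    have h5 : θ x = mfderiv 𝓘(ℝ, E) 𝓘(ℝ, ℝ) f (x : M) :=
      hasMFDerivAt_unique (f := fun z : U => f z) (x := x) h2 (hrestr h4)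
    refine ⟨h3, ?_⟩
    rw [h5]
    exact h4.hasMFDerivAt
  · rintro ⟨h1, h2⟩
    exact ⟨contMDiffAt_subtype_iff.2 h1, h2.comp x (hasMFDerivAt_subtype_val x)⟩

/-- Primitives on an open subset and their extensions by zero. -/
lemma isPrimitiveAt_extend_iff {f : U → ℝ} {θ : U → E →L[ℝ] ℝ} (x : U) :
    IsPrimitiveAt (Function.extend Subtype.val f 0) (Function.extend Subtype.val θ 0) (x : M) ↔
      IsPrimitiveAt f θ x := by
  rw [← isPrimitiveAt_restrict_iff]
  simp only [Subtype.val_injective.extend_apply]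

end Opens

/-! ### Cutting off the primitive at infinity -/

section Main

variable {E : Type*} [NormedAddCommGroup E] [NormedSpace ℝ E]
variable {M : Type*} [TopologicalSpace M] [ChartedSpace E M] [IsManifold 𝓘(ℝ, E) ∞ M]

/-- If every locally exact `1`-form on the compact manifold `M` is exact, then every closed `1`-form
on an open subset of `M` that is exact outside a compact set is exact. -/
lemma isExactOn_univ_of_isExactOn_compl [FiniteDimensional ℝ E] [T2Space M] [CompactSpace M]
    (hM : ∀ θ : M → E →L[ℝ] ℝ,
      (∀ x, ∃ f : M → ℝ, ∀ᶠ z in 𝓝 x, IsPrimitiveAt f θ z) →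
        ∃ f : M → ℝ, ∀ x, IsPrimitiveAt f θ x)
    {U : TopologicalSpace.Opens M} {α : RoughForm E U 1} (hα : α ∈ closedForms E U 1)
    {K : Set U} (hK : IsCompact K) (hαK : IsExactOn α Kᶜ) : IsExactOn α Set.univ := by
  classical
  obtain ⟨f, hf⟩ := (isExactOn_iff_exists_isPrimitiveAt hK.isClosed.isOpen_compl).1 hαK
  have hK' : IsCompact (Subtype.val '' K) := hK.image continuous_subtype_val
  obtain ⟨χ, hχ0, hχ1, -⟩ := exists_contMDiffMap_zero_one_nhds_of_isClosed (n := ⊤) 𝓘(ℝ, E)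
    hK'.isClosed U.isOpen.isClosed_compl
    (Set.disjoint_compl_right_iff_subset.2 (Subtype.coe_image_subset _ _))
  set g : U → ℝ := fun x => χ x * f x with hg
  have hgsm : ∀ x, ContMDiffAt 𝓘(ℝ, E) 𝓘(ℝ, ℝ) ∞ g x := fun x => by
    by_cases hx : x ∈ K
    -- `f` is uncontrolled on `K`, so `χ` must vanish on a whole neighbourhood of it.
    · have h1 : ∀ᶠ z in 𝓝 (x : M), χ z = 0 :=
        eventually_nhdsSet_iff_forall.1 hχ0 _ ⟨x, hx, rfl⟩
      have h2 : g =ᶠ[𝓝 x] fun _ => 0 := by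
        filter_upwards [continuous_subtype_val.continuousAt.eventually h1] with z hz
        simp [hg, hz]
      exact contMDiffAt_const.congr_of_eventuallyEq h2
    · exact (contMDiffAt_subtype_iff.2 χ.contMDiff.contMDiffAt).mul (hf x hx).1
  let dg : U → E →L[ℝ] ℝ := fun x => mfderiv 𝓘(ℝ, E) 𝓘(ℝ, ℝ) g x
  have hgd : ∀ x, IsPrimitiveAt g dg x := fun x =>
    ⟨hgsm x, ((hgsm x).mdifferentiableAt (by simp)).hasMFDerivAt⟩
  obtain ⟨F, hF⟩ := hM (Function.extend Subtype.val (α.toCovector - dg) 0) fun x => by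
    by_cases hx : x ∈ U
    · lift x to U using hx
      obtain ⟨p, hp⟩ := exists_eventually_isPrimitiveAt hα x
      refine ⟨Function.extend Subtype.val (p - g) 0, ?_⟩
      rw [← U.isOpen.isOpenEmbedding_subtypeVal.map_nhds_eq, Filter.eventually_map]
      exact hp.mono fun z hz => (isPrimitiveAt_extend_iff z).2 (hz.sub (hgd z))
    · refine ⟨fun _ => 0, ?_⟩
      have h1 : ∀ᶠ z in 𝓝 x, χ z = 1 := eventually_nhdsSet_iff_forall.1 hχ1 x hx
      -- Near a point outside `U`, `χ = 1` on a neighbourhood of each `z`; there `g = f` as germs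
      -- and `dg = df = α` off `K`, so the extension is zero.
      filter_upwards [h1.eventually_nhds, hK'.isClosed.isOpen_compl.mem_nhds fun h =>
        hx (Subtype.coe_image_subset _ _ h)] with z hz hzK
      refine (isPrimitiveAt_const 0 z).congr_form ?_
      by_cases hzU : z ∈ U
      · lift z to U using hzU
        have hzK' : z ∈ Kᶜ := fun h => hzK ⟨z, h, rfl⟩
        have h2 : f =ᶠ[𝓝 z] g := by
          filter_upwards [continuous_subtype_val.continuousAt.eventually hz] with w hw
          simp [hg, hw]
        have h3 : α.toCovector z = dg z :=
          hasMFDerivAt_unique (f := f) (x := z) (hf z hzK').2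
            ((hgd z).congr h2).2
        rw [Subtype.val_injective.extend_apply, Pi.sub_apply, h3, sub_self, Pi.zero_apply]
      · exact Function.extend_apply' _ _ _ fun ⟨w, hw⟩ => hzU (hw ▸ w.2)
  refine (isExactOn_iff_exists_isPrimitiveAt isOpen_univ).2
    ⟨(fun x : U => F x) + g, fun x _ => ?_⟩
  have h1 := ((isPrimitiveAt_restrict_iff x).2 (hF x)).add (hgd x)
  refine h1.congr_form ?_
  simp only [Pi.add_apply, Subtype.val_injective.extend_apply, Pi.sub_apply, sub_add_cancel]

end Main

end OpenGenus

end

/-! ### Open subsets of the 2-sphere -/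

theorem mainTheorem10
    (U : TopologicalSpace.Opens (Metric.sphere (0 : EuclideanSpace ℝ (Fin 3)) 1)) :
    OpenGenus.c (EuclideanSpace ℝ (Fin 2)) U 1 = 0 := by
  have hexact : ∀ α ∈ OpenGenus.closedFormsExactAtInfinity (EuclideanSpace ℝ (Fin 2)) U 1,
      α ∈ OpenGenus.exactForms (EuclideanSpace ℝ (Fin 2)) U 1 := by
    rintro α ⟨hα, K, hK, hαK⟩
    have : Fact (Module.finrank ℝ (EuclideanSpace ℝ (Fin 3)) = 2 + 1) :=
      ⟨finrank_euclideanSpace_fin⟩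
    exact OpenGenus.isExactOn_univ_of_isExactOn_compl
      (fun θ hθ => OpenGenus.exists_isPrimitiveAt_sphere (F := EuclideanSpace ℝ (Fin 3)) le_rfl hθ)
      hα hK hαK
  have hsub : Subsingleton (OpenGenus.HBar (EuclideanSpace ℝ (Fin 2)) U 1) := by
    rw [Submodule.Quotient.subsingleton_iff, Submodule.submoduleOf_eq_top]
    exact hexact
  exact rank_subsingleton' _ _
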